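/- Let $b\ge 1$ be a fixed integer, $\varepsilon>0$, $P_{\max}>0$ and $N_0>0$. For $N\ge 1$ let there be $N$ users and $K=bN$ channels, and let $g_{n,k}$ be the gain of user $n$ in channel $k$. All the gains $g_{n,k}$ ($1\le n\le N$, $1\le k\le K$) are independent, and for each user $n$ the gains $g_{n,1},\dots,g_{n,K}$ have a common CDF $F_n$. Each $F_n$ is continuous and has an exponentially-dominated tail: there are $\alpha_n>0$, $\beta_n\in\mathbb R$, $\lambda_n>0$, $\gamma_n>0$ with $$\lim_{x\to\infty}\frac{1-F_n(x)}{\alpha_n x^{\beta_n}e^{-\lambda_n x^{\gamma_n}}}=1,$$ uniformly in $n$, where $\alpha_n,\lambda_n,\gamma_n$ stay in a compact subset of $(0,\infty)$ and $\beta_n$ stays bounded. (If all users have the same distribution, the uniformity holds automatically.) The gains are nonnegative or, more generally, there is a constant $C$ such that $\Pr(g_{n,k}<-x)\le C\,\Pr(g_{n,k}>x)$ for all $n,k$ and all large $x$. An allocation $(\mathcal A_1,\dots,\mathcal A_N)$ gives each user $n$ a set $\mathcal A_n$ of $b$ channels, the sets being pairwise disjoint; the rate of user $n$ is $$R_n(\mathcal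 A_n)=\sum_{k\in\mathcal A_n}\log_2\Bigl(1+\frac{g_{n,k}^2P_{\max}}{bN_0}\Bigr).$$ Let $M=\lceil (b+1)(1+\varepsilon)\ln K\rceil$. The user-channel graph is the bipartite graph with $b$ nodes (agents) for each user and one node for each channel, in which every agent of user $n$ is joined to channel $k$ if and only if $k$ is one of the $M$ channels with the largest gains for user $n$ (all the channels, if $M\ge K$). Let $\mathcal P$ be the set of allocations that come from perfect matchings of this graph ($\mathcal A_n$ being the set of channels matched to the agents of user $n$); a minimum over $\mathcal P$ is read as $0$ if $\mathcal P=\emptyset$. Then, in probability as $K=bN\to\infty$, $$\frac{\min_{(\mathcal A_1,\dots,\mathcal A_N)\in\mathcal P}\sum_{n=1}^N R_n(\mathcal A_n)}{\max_{(\mathcal A_1,\dots,\mathcal A_N)}\sum_{n=1}^N R_n(\mathcal A_n)}\longrightarrow 1 .$$ Furthermore, if $\gamma_n$ is the same for all users (in particular, if the gains of all users are identically distributed), then, in probability, $$\frac{\min_{(\mathcal A_1,\dots,\mathcal A_N)\in\mathcal P}\min_n R_n(\mathcal A_n)}{\max_{(\mathcal A_1,\dots,\mathcal A_N)}\max_n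 R_n(\mathcal A_n)}\longrightarrow 1 .$$ The maxima are over all allocations. -/

import Mathlib

open Filter Topology MeasureTheory ProbabilityTheory

namespace ChannelAllocation

noncomputable section

/-! ### Tails of the channel gains -/

/-- The comparison function `x ↦ α x ^ β exp (-lam x ^ γ)`. -/
def tailProfile (α β lam γ x : ℝ) : ℝ :=
  α * x ^ β * Real.exp (-lam * x ^ γ)

/-- The ratio of the upper tail `1 - F x` of the law `ν` (with CDF `F`) to the comparison
function. -/
def tailRatio (ν : Measure ℝ) (α β lam γ x : ℝ) : ℝ :=
  (1 - cdf ν x) / tailProfile α β lam γ x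

/-- The law `ν` has an exponentially-dominated tail with parameters `α, β, lam, γ`. -/
structure HasExpDominatedTail (ν : Measure ℝ) (α β lam γ : ℝ) : Prop where
  continuous_cdf : Continuous (cdf ν)
  alpha_pos : 0 < α
  lam_pos : 0 < lam
  gamma_pos : 0 < γ
  tendsto_ratio : Tendsto (tailRatio ν α β lam γ) atTop (𝓝 1)

/-- The laws `ν n` have exponentially-dominated tails with parameters `α n, β n, lam n, γ n`,
uniformly in `n`: the parameters stay in a compact part of their domain, and the limit that
defines the tail is uniform in `n`. For a sequence of laws and parameters that does not depend on
`n` this is just `HasExpDominatedTail`, see `uniformExpDominatedTail_const`. -/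
structure UniformExpDominatedTail (ν : ℕ → Measure ℝ) (α β lam γ : ℕ → ℝ) : Prop where
  tail : ∀ n, HasExpDominatedTail (ν n) (α n) (β n) (lam n) (γ n)
  bounds : ∃ c C : ℝ, 0 < c ∧ ∀ n, α n ∈ Set.Icc c C ∧ β n ∈ Set.Icc (-C) C ∧
    lam n ∈ Set.Icc c C ∧ γ n ∈ Set.Icc c C
  uniform : TendstoUniformly
    (fun (x : ℝ) (n : ℕ) => tailRatio (ν n) (α n) (β n) (lam n) (γ n) x) (fun _ => 1) atTop

/-- Identically distributed users: uniformity is automatic. -/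
theorem uniformExpDominatedTail_const {ν : Measure ℝ} {α β lam γ : ℝ} :
    UniformExpDominatedTail (fun _ => ν) (fun _ => α) (fun _ => β) (fun _ => lam) (fun _ => γ) ↔
      HasExpDominatedTail ν α β lam γ := by
  refine ⟨fun h => h.tail 0, fun h => ⟨fun _ => h, ?_, ?_⟩⟩
  · refine ⟨min α (min lam γ), max α (max |β| (max lam γ)),
      lt_min h.alpha_pos (lt_min h.lam_pos h.gamma_pos), fun _ => ⟨⟨?_, ?_⟩, ?_, ⟨?_, ?_⟩, ⟨?_, ?_⟩⟩⟩
    · simp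
    · simp
    · exact abs_le.mp (by simp)
    all_goals simp
  · rw [Metric.tendstoUniformly_iff]
    intro e he
    have h1 := Metric.tendsto_nhds.mp h.tendsto_ratio e he
    filter_upwards [h1] with x hx _
    rw [dist_comm]
    exact hx

/-! ### Allocations of `K` channels to `N` users with gain matrix `h` -/

variable {N K : ℕ}

/-- Channel `k` is one of the `M`-best channels of user `n`: fewer than `M` channels have a
strictly larger gain for this user. -/
def IsMBest (M : ℕ) (h : Fin N → Fin K → ℝ) (n : Fin N) (k : Fin K) : Prop :=
  (Finset.univ.filter fun j => h n k < h n j).card < M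

/-- The user-channel graph: user `n` has the `b` nodes (agents) `(n, i)`, each channel has one
node, and an agent of user `n` is joined to channel `k` iff `k` is one of the `M`-best channels of
user `n`. -/
def userChannelGraph (b M : ℕ) (h : Fin N → Fin K → ℝ) :
    SimpleGraph ((Fin N × Fin b) ⊕ Fin K) where
  Adj
    | Sum.inl a, Sum.inr k => IsMBest M h a.1 k
    | Sum.inr k, Sum.inl a => IsMBest M h a.1 k
    | _, _ => False
  symm := ⟨by rintro (a | k) (a' | k') <;> simp⟩
  loopless := ⟨by rintro (a | k) <;> simp⟩

/-- An allocation: every user gets `b` channels and no channel is given to two users. -/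
def IsAllocation (b : ℕ) (A : Fin N → Finset (Fin K)) : Prop :=
  (∀ n, (A n).card = b) ∧ Pairwise fun n m => Disjoint (A n) (A m)

/-- A perfect-matching allocation: for some perfect matching of the user-channel graph, `A n` is
the set of the channels matched to the agents of user `n`. -/
def IsPMAllocation (b M : ℕ) (h : Fin N → Fin K → ℝ) (A : Fin N → Finset (Fin K)) : Prop :=
  ∃ P : (userChannelGraph b M h).Subgraph, P.IsPerfectMatching ∧
    ∀ n k, k ∈ A n ↔ ∃ i : Fin b, P.Adj (Sum.inl (n, i)) (Sum.inr k)

/-- The rate of user `n` when he is allocated the set `S` of channels. -/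
def rate (b : ℕ) (Pmax N₀ : ℝ) (h : Fin N → Fin K → ℝ) (n : Fin N) (S : Finset (Fin K)) : ℝ :=
  ∑ k ∈ S, Real.logb 2 (1 + h n k ^ 2 * Pmax / (b * N₀))

/-- The worst sum-rate over the perfect-matching allocations. The index type is finite; the value
is `0` if there is no perfect matching. -/
def worstPMSumRate (b M : ℕ) (Pmax N₀ : ℝ) (h : Fin N → Fin K → ℝ) : ℝ :=
  ⨅ A : {A : Fin N → Finset (Fin K) // IsPMAllocation b M h A},
    ∑ n, rate b Pmax N₀ h n (A.1 n)

/-- The optimal sum-rate over all allocations. -/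
def bestSumRate (b : ℕ) (Pmax N₀ : ℝ) (h : Fin N → Fin K → ℝ) : ℝ :=
  ⨆ A : {A : Fin N → Finset (Fin K) // IsAllocation b A},
    ∑ n, rate b Pmax N₀ h n (A.1 n)

/-- The worst minimal rate over the perfect-matching allocations. The index types are finite; the
value is `0` if there is no perfect matching. -/
def worstPMMinRate (b M : ℕ) (Pmax N₀ : ℝ) (h : Fin N → Fin K → ℝ) : ℝ :=
  ⨅ A : {A : Fin N → Finset (Fin K) // IsPMAllocation b M h A},
    ⨅ n, rate b Pmax N₀ h n (A.1 n)

/-- The best rate of a single user over all allocations. -/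
def bestUserRate (b : ℕ) (Pmax N₀ : ℝ) (h : Fin N → Fin K → ℝ) : ℝ :=
  ⨆ A : {A : Fin N → Finset (Fin K) // IsAllocation b A},
    ⨆ n, rate b Pmax N₀ h n (A.1 n)

/-- The number `M = ⌈(b + 1) (1 + ε) ln K⌉` of best channels. -/
def numBest (b : ℕ) (ε : ℝ) (K : ℕ) : ℕ :=
  ⌈((b : ℝ) + 1) * (1 + ε) * Real.log K⌉₊

end

end ChannelAllocation

/-! Write `L = ln K`. A rate depends on a gain only through its logarithm, and on that scale all
`M`-best gains of a user agree. With probability tending to 1, every `M`-best gain of user `n`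
exceeds `(a L) ^ (1 / γ n)`, and every gain has absolute value at most `(A L) ^ (1 / γ n)`, for
constants `a`, `A` independent of `n`. Both thresholds give the rate `(2 / γ n) log₂ L` up to a
factor `1 + o(1)`. So any perfect matching is nearly optimal as soon as one exists, and with equal
`γ n` even the minimal and maximal user rates agree asymptotically.

Existence is Hall's theorem with a union bound. If it fails, some `s` users have all their best
channels inside a set of fewer than `b s` channels. By exchangeability (`measure_topSet_subset_le`)
and independence, a fixed set of `τ` channels contains them with probability at most `(τ / K) ^ (M
s)`. For `s ≤ (1 - δ) N` this beats the binomial coefficients because `M → ∞`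
(`hall_term_le_of_small`); for `s` near `N` it does so because of the constant `(b + 1)(1 + ε)` in
`M` (`hall_term_le_of_large`).

The thresholds come from the tails: `eventually_tail_mem_Icc` turns them into powers of `K`, and
`IsTypical` collects the good event. -/

namespace ChannelAllocation

/-! ### Matchings and rates for a fixed gain matrix -/

section Deterministic

variable {N K b M : ℕ}

/-- The set of the `M`-best channels for the gain vector `x`. -/
noncomputable def topSet (M : ℕ) (x : Fin K → ℝ) : Finset (Fin K) :=
  Finset.univ.filter fun k => (Finset.univ.filter fun j => x k < x j).card < M

lemma mem_topSet {x : Fin K → ℝ} {k : Fin K} :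
    k ∈ topSet M x ↔ (Finset.univ.filter fun j => x k < x j).card < M := by
  simp [topSet]

lemma isMBest_iff_mem_topSet {h : Fin N → Fin K → ℝ} {n : Fin N} {k : Fin K} :
    IsMBest M h n k ↔ k ∈ topSet M (h n) := mem_topSet.symm

/-- Only members of the top set can beat a channel of largest gain outside it; were they fewer than
`M`, that channel would be `M`-best too. Ties can make the top set larger than `M`. -/
lemma le_card_topSet (hM : M ≤ K) (x : Fin K → ℝ) : M ≤ (topSet M x).card := by
  by_contra! hlt
  obtain ⟨k₀, hk₀⟩ : ∃ k, k ∉ topSet M x := by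
    by_contra! hall
    have : topSet M x = Finset.univ := by ext k; simp [hall k]
    rw [this, Finset.card_univ, Fintype.card_fin] at hlt
    omega
  obtain ⟨k, hk, hmax⟩ := (topSet M x)ᶜ.exists_max_image x ⟨k₀, by simpa using hk₀⟩
  refine Finset.mem_compl.1 hk (mem_topSet.2 (lt_of_le_of_lt (Finset.card_le_card ?_) hlt))
  intro j hj
  by_contra hj'
  exact absurd (hmax j (Finset.mem_compl.2 hj')) (not_le.2 (Finset.mem_filter.1 hj).2)

lemma lt_of_mem_topSet {x : Fin K → ℝ} {l : ℝ}
    (hl : M ≤ (Finset.univ.filter fun j => l < x j).card) {k : Fin K} (hk : k ∈ topSet M x) :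
    l < x k := by
  by_contra! hle
  refine absurd (mem_topSet.1 hk) (not_lt.2 (hl.trans (Finset.card_le_card ?_)))
  intro j hj
  simp only [Finset.mem_filter, Finset.mem_univ, true_and] at hj ⊢
  exact hle.trans_lt hj

lemma IsPMAllocation.mem_topSet {h : Fin N → Fin K → ℝ} {A : Fin N → Finset (Fin K)}
    (hA : IsPMAllocation b M h A) {n : Fin N} {k : Fin K} (hk : k ∈ A n) :
    k ∈ topSet M (h n) := by
  obtain ⟨P, -, hP⟩ := hA
  obtain ⟨i, hi⟩ := (hP n k).1 hk
  exact isMBest_iff_mem_topSet.1 hi.adj_sub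

lemma IsPMAllocation.isAllocation {h : Fin N → Fin K → ℝ} {A : Fin N → Finset (Fin K)}
    (hA : IsPMAllocation b M h A) : IsAllocation b A := by
  obtain ⟨P, ⟨hP, hs⟩, hPA⟩ := hA
  have hchan : ∀ (n : Fin N) (i : Fin b), ∃ k : Fin K, P.Adj (Sum.inl (n, i)) (Sum.inr k) := by
    intro n i
    obtain ⟨w, hw, -⟩ := hP (hs (Sum.inl (n, i)))
    rcases w with w | w
    · exact absurd hw.adj_sub (by simp [userChannelGraph])
    · exact ⟨w, hw⟩
  choose f hf using hchan
  have huniq : ∀ {a a' : Fin N × Fin b} {k : Fin K},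
      P.Adj (Sum.inl a) (Sum.inr k) → P.Adj (Sum.inl a') (Sum.inr k) → a = a' := by
    intro a a' k h1 h2
    exact Sum.inl_injective ((hP (hs (Sum.inr k))).unique h1.symm h2.symm)
  refine ⟨fun n => ?_, fun n m hnm => Finset.disjoint_left.2 fun k hk hk' => ?_⟩
  · have : A n = Finset.univ.image (f n) := by
      ext k
      simp only [hPA, Finset.mem_image, Finset.mem_univ, true_and]
      refine exists_congr fun i => ⟨fun hi => ?_, fun hi => hi ▸ hf n i⟩
      exact Sum.inr_injective ((hP (hs (Sum.inl (n, i)))).unique (hf n i) hi)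
    rw [this, Finset.card_image_of_injective, Finset.card_univ, Fintype.card_fin]
    intro i j hij
    have h1 := hf n i
    rw [hij] at h1
    simpa using huniq h1 (hf n j)
  · obtain ⟨i, hi⟩ := (hPA n k).1 hk
    obtain ⟨j, hj⟩ := (hPA m k).1 hk'
    exact hnm (congrArg Prod.fst (huniq hi hj))

lemma exists_isPMAllocation {h : Fin N → Fin (b * N) → ℝ}
    (hall : ∀ S : Finset (Fin N), b * S.card ≤ (S.biUnion fun n => topSet M (h n)).card) :
    ∃ A, IsPMAllocation b M h A := by
  classical
  have hHall : ∀ s : Finset (Fin N × Fin b),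
      s.card ≤ (s.biUnion fun a => topSet M (h a.1)).card := by
    intro s
    -- All agents of a user have the same neighbours, and `s` agents belong to at least `s / b`
    -- users, so Hall's condition for users suffices.
    have h1 : s.card ≤ b * (s.image Prod.fst).card := by
      have : s ⊆ (s.image Prod.fst) ×ˢ Finset.univ := fun a ha => by
        simpa using ⟨a.2, ha⟩
      simpa [Finset.card_product, mul_comm] using Finset.card_le_card this
    have h2 : ((s.image Prod.fst).biUnion fun n => topSet M (h n))
        = s.biUnion fun a => topSet M (h a.1) := by
      rw [Finset.image_biUnion]
    exact h2 ▸ h1.trans (hall _)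
  obtain ⟨f, hf, hfm⟩ := (Finset.all_card_le_biUnion_card_iff_exists_injective _).1 hHall
  -- There are as many agents as channels, so a matching that saturates the agents is perfect.
  have hfs : Function.Surjective f :=
    ((Fintype.bijective_iff_injective_and_card f).2 ⟨hf, by simp [mul_comm]⟩).2
  refine ⟨fun n => Finset.univ.image fun i => f (n, i), ?_⟩
  let P : (userChannelGraph b M h).Subgraph :=
    { verts := Set.univ
      Adj := fun u v => match u, v with
        | Sum.inl a, Sum.inr k => f a = k
        | Sum.inr k, Sum.inl a => f a = k
        | _, _ => False
      adj_sub := by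
        rintro (a | k) (a' | k') huv
        · exact huv.elim
        · subst huv
          exact isMBest_iff_mem_topSet.2 (hfm a)
        · subst huv
          exact isMBest_iff_mem_topSet.2 (hfm a')
        · exact huv.elim
      edge_vert := fun _ => Set.mem_univ _
      symm := ⟨by rintro (a | k) (a' | k') huv <;> exact huv⟩ }
  refine ⟨P, ⟨?_, fun v => Set.mem_univ v⟩, fun n k => ?_⟩
  · rintro (a | k) -
    · refine ⟨Sum.inr (f a), rfl, ?_⟩
      rintro (a' | k) hk
      · exact hk.elim
      · exact congrArg Sum.inr (show f a = k from hk).symm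
    · obtain ⟨a, ha⟩ := hfs k
      refine ⟨Sum.inl a, ha, ?_⟩
      rintro (a' | k') hk
      · exact congrArg Sum.inl (hf ((show f a' = k from hk).trans ha.symm))
      · exact hk.elim
  · simp only [Finset.mem_image, Finset.mem_univ, true_and]
    rfl

/-- Hall's condition, and rates of order `ρ` up to the relative error `η`: the pointwise conditions
under which every perfect-matching allocation is nearly optimal. -/
structure IsTypical (b M : ℕ) (Pmax N₀ η : ℝ) (ρ : Fin N → ℝ) (h : Fin N → Fin (b * N) → ℝ) :
    Prop where
  hall : ∀ S : Finset (Fin N), b * S.card ≤ (S.biUnion fun n => topSet M (h n)).card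
  lower : ∀ n, ∀ k ∈ topSet M (h n),
    (1 - η) * ρ n ≤ Real.logb 2 (1 + h n k ^ 2 * Pmax / (b * N₀))
  upper : ∀ n k, Real.logb 2 (1 + h n k ^ 2 * Pmax / (b * N₀)) ≤ (1 + η) * ρ n

variable {Pmax N₀ η : ℝ} {ρ : Fin N → ℝ} {h : Fin N → Fin (b * N) → ℝ}

lemma IsTypical.le_rate (ht : IsTypical b M Pmax N₀ η ρ h) {A : Fin N → Finset (Fin (b * N))}
    (hA : IsPMAllocation b M h A) (n : Fin N) :
    b * ((1 - η) * ρ n) ≤ rate b Pmax N₀ h n (A n) := by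
  have := Finset.card_nsmul_le_sum (A n) _ _ fun k hk => ht.lower n k (hA.mem_topSet hk)
  rwa [hA.isAllocation.1 n, nsmul_eq_mul] at this

lemma IsTypical.rate_le (ht : IsTypical b M Pmax N₀ η ρ h) {A : Fin N → Finset (Fin (b * N))}
    (hA : IsAllocation b A) (n : Fin N) :
    rate b Pmax N₀ h n (A n) ≤ b * ((1 + η) * ρ n) := by
  have := Finset.sum_le_card_nsmul (A n) _ _ fun k _ => ht.upper n k
  rwa [hA.1 n, nsmul_eq_mul] at this

/-- This rests on `(1 - 2η)(1 + η) ≤ 1 - η`. -/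
lemma abs_div_sub_one_le {W B r : ℝ} (hη : 0 < η) (hη1 : η < 1) (hr : 0 < r)
    (hW : (1 - η) * r ≤ W) (hWB : W ≤ B) (hB : B ≤ (1 + η) * r) : |W / B - 1| ≤ 2 * η := by
  have hB0 : 0 < B := lt_of_lt_of_le (mul_pos (by linarith) hr) (hW.trans hWB)
  have h1 : W / B ≤ 1 := (div_le_one hB0).2 hWB
  have h2 : 1 - 2 * η ≤ W / B := by
    rw [le_div_iff₀ hB0]
    by_cases h : 0 ≤ 1 - 2 * η
    · calc (1 - 2 * η) * B ≤ (1 - 2 * η) * ((1 + η) * r) := by gcongr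
        _ ≤ (1 - η) * r := by nlinarith [mul_pos (mul_pos hη hη) hr]
        _ ≤ W := hW
    · have : (1 - 2 * η) * B ≤ 0 := mul_nonpos_of_nonpos_of_nonneg (by linarith) hB0.le
      have : 0 ≤ (1 - η) * r := mul_nonneg (by linarith) hr.le
      linarith
  rw [abs_le]
  constructor <;> linarith

lemma IsTypical.abs_sumRate_ratio_sub_one_le (ht : IsTypical b M Pmax N₀ η ρ h) (hb : 1 ≤ b)
    (hN : 1 ≤ N) (hη : 0 < η) (hη1 : η < 1) (hρ : ∀ n, 0 < ρ n) :
    |worstPMSumRate b M Pmax N₀ h / bestSumRate b Pmax N₀ h - 1| ≤ 2 * η := by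
  have : Nonempty (Fin N) := ⟨⟨0, hN⟩⟩
  -- Existence rules out the default value 0 of an empty infimum; `A₀` also witnesses that the worst
  -- matching is at most the best allocation.
  obtain ⟨A₀, hA₀⟩ := exists_isPMAllocation ht.hall
  have : Nonempty {A // IsPMAllocation b M h A} := ⟨⟨A₀, hA₀⟩⟩
  have : Nonempty {A : Fin N → Finset (Fin (b * N)) // IsAllocation b A} :=
    ⟨⟨A₀, hA₀.isAllocation⟩⟩
  have hr : 0 < ∑ n, b * ρ n :=
    Finset.sum_pos (fun n _ => mul_pos (by exact_mod_cast hb) (hρ n)) Finset.univ_nonempty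
  refine abs_div_sub_one_le hη hη1 hr (le_ciInf fun A => ?_) ?_ (ciSup_le fun A => ?_)
  · rw [Finset.mul_sum]
    refine Finset.sum_le_sum fun n _ => le_of_eq_of_le (by ring) (ht.le_rate A.2 n)
  · exact (ciInf_le (Set.finite_range _).bddBelow ⟨A₀, hA₀⟩).trans
      (le_ciSup (f := fun A : {A : Fin N → Finset (Fin (b * N)) // IsAllocation b A} =>
        ∑ n, rate b Pmax N₀ h n (A.1 n)) (Set.finite_range _).bddAbove ⟨A₀, hA₀.isAllocation⟩)
  · rw [Finset.mul_sum]
    refine Finset.sum_le_sum fun n _ => (ht.rate_le A.2 n).trans_eq (by ring)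

lemma IsTypical.abs_userRate_ratio_sub_one_le (ht : IsTypical b M Pmax N₀ η ρ h) (hb : 1 ≤ b)
    (hN : 1 ≤ N) (hη : 0 < η) (hη1 : η < 1) {r : ℝ} (hr : 0 < r) (hρ : ∀ n, ρ n = r) :
    |worstPMMinRate b M Pmax N₀ h / bestUserRate b Pmax N₀ h - 1| ≤ 2 * η := by
  have : Nonempty (Fin N) := ⟨⟨0, hN⟩⟩
  obtain ⟨A₀, hA₀⟩ := exists_isPMAllocation ht.hall
  have : Nonempty {A // IsPMAllocation b M h A} := ⟨⟨A₀, hA₀⟩⟩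
  have : Nonempty {A : Fin N → Finset (Fin (b * N)) // IsAllocation b A} :=
    ⟨⟨A₀, hA₀.isAllocation⟩⟩
  have hr' : 0 < b * r := mul_pos (by exact_mod_cast hb) hr
  refine abs_div_sub_one_le hη hη1 hr' (le_ciInf fun A => le_ciInf fun n => ?_) ?_
    (ciSup_le fun A => ciSup_le fun n => ?_)
  · exact le_of_eq_of_le (by rw [hρ]; ring) (ht.le_rate A.2 n)
  · refine (ciInf_le (Set.finite_range _).bddBelow ⟨A₀, hA₀⟩).trans ?_
    refine le_trans ?_ (le_ciSup
      (f := fun A : {A : Fin N → Finset (Fin (b * N)) // IsAllocation b A} =>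
        ⨆ n, rate b Pmax N₀ h n (A.1 n)) (Set.finite_range _).bddAbove ⟨A₀, hA₀.isAllocation⟩)
    exact ciInf_le_ciSup (Set.finite_range _).bddBelow (Set.finite_range _).bddAbove
  · exact (ht.rate_le A.2 n).trans_eq (by rw [hρ]; ring)

end Deterministic

/-! ### Union bounds under the product law -/

section Probability

variable {N K b M : ℕ}

lemma hasLaw_gainMatrix {Ω : Type*} [MeasurableSpace Ω] {μ : Measure Ω}
    {ν : Fin N → Measure ℝ} [∀ n, IsProbabilityMeasure (ν n)] {g : Fin N → Fin K → Ω → ℝ}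
    (hlaw : ∀ n k, HasLaw (g n k) (ν n) μ)
    (hindep : iIndepFun (fun p : Fin N × Fin K => g p.1 p.2) μ) :
    HasLaw (fun ω n k => g n k ω) (Measure.pi fun n => Measure.pi fun _ : Fin K => ν n) μ := by
  have h1 := hindep.hasLaw_pi (μ := fun p => ν p.1) fun p => hlaw p.1 p.2
  have h2 : (Measure.pi fun p : Fin N × Fin K => ν p.1).map
      (MeasurableEquiv.curry (Fin N) (Fin K) ℝ)
        = Measure.pi fun n => Measure.pi fun _ : Fin K => ν n := by
    simpa only [Measure.infinitePi_eq_pi] using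
      Measure.infinitePi_map_curry (X := ℝ) (fun (n : Fin N) (_ : Fin K) => ν n)
  have h3 : HasLaw (MeasurableEquiv.curry (Fin N) (Fin K) ℝ)
      (Measure.pi fun n => Measure.pi fun _ : Fin K => ν n)
      (Measure.pi fun p : Fin N × Fin K => ν p.1) :=
    ⟨(MeasurableEquiv.curry (Fin N) (Fin K) ℝ).measurable.aemeasurable, h2⟩
  exact h3.comp h1

/-- A channel is not `M`-best iff some `M` channels beat it, so the event is a finite combination of
the sets `x k < x j`. -/
lemma measurableSet_topSet_subset (T : Finset (Fin K)) :
    MeasurableSet {x : Fin K → ℝ | topSet M x ⊆ T} := by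
  have : {x : Fin K → ℝ | topSet M x ⊆ T} = ⋂ k ∈ Tᶜ, ⋃ J : Finset (Fin K),
      ⋃ (_ : M ≤ J.card), ⋂ j ∈ J, {x : Fin K → ℝ | x k < x j} := by
    ext x
    simp only [Set.mem_ofPred_eq, Set.mem_iInter, Set.mem_iUnion, Finset.mem_compl]
    refine ⟨fun h k hk => ?_, fun h k hk => ?_⟩
    · have := fun h' => hk (h (mem_topSet.2 h'))
      exact ⟨_, not_lt.1 this, fun j hj => (Finset.mem_filter.1 hj).2⟩
    · by_contra hkT
      obtain ⟨J, hJ, hJ'⟩ := h k hkT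
      refine absurd (mem_topSet.1 hk) (not_lt.2 (hJ.trans (Finset.card_le_card fun j hj => ?_)))
      simpa using hJ' j hj
  rw [this]
  refine Finset.measurableSet_biInter _ fun k _ => MeasurableSet.iUnion fun J =>
    MeasurableSet.iUnion fun _ => Finset.measurableSet_biInter _ fun j _ =>
    measurableSet_lt (measurable_pi_apply k) (measurable_pi_apply j)

lemma topSet_comp_subset_iff (σ : Equiv.Perm (Fin K)) (x : Fin K → ℝ) (T : Finset (Fin K)) :
    topSet M (fun k => x (σ k)) ⊆ T ↔ topSet M x ⊆ T.map σ.toEmbedding := by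
  have key : ∀ k, k ∈ topSet M (fun k => x (σ k)) ↔ σ k ∈ topSet M x := by
    intro k
    rw [mem_topSet, mem_topSet, ← Finset.card_map σ.toEmbedding]
    have : (Finset.univ.filter fun j => x (σ k) < x (σ j)).map σ.toEmbedding
        = Finset.univ.filter fun j => x (σ k) < x j := by
      ext j
      simp only [Finset.mem_map, Finset.mem_filter, Finset.mem_univ, true_and,
        Equiv.coe_toEmbedding]
      exact ⟨fun ⟨i, hi, h⟩ => h ▸ hi, fun h => ⟨σ.symm j, by simpa using h, by simp⟩⟩
    rw [this]
  refine ⟨fun h k hk => ?_, fun h k hk => ?_⟩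
  · rw [Finset.mem_map_equiv]
    exact h ((key _).2 (by simpa using hk))
  · simpa using h ((key k).1 hk)

lemma exists_perm_map_eq {T T' : Finset (Fin K)} (h : T.card = T'.card) :
    ∃ σ : Equiv.Perm (Fin K), T.map σ.toEmbedding = T' := by
  classical
  let e : {k // k ∈ T} ≃ {k // k ∈ T'} := Finset.equivOfCardEq h
  refine ⟨e.extendSubtype, Finset.eq_of_subset_of_card_le (fun k hk => ?_) (by simp [h])⟩
  obtain ⟨j, hj, rfl⟩ := Finset.mem_map.1 hk
  exact e.extendSubtype_mem j hj

lemma measurePreserving_comp_perm (ν : Measure ℝ) [IsProbabilityMeasure ν]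
    (σ : Equiv.Perm (Fin K)) :
    MeasurePreserving (fun (x : Fin K → ℝ) k => x (σ k)) (Measure.pi fun _ => ν)
      (Measure.pi fun _ => ν) := by
  have h := measurePreserving_piCongrLeft (α := fun _ : Fin K => ℝ) (fun _ => ν) σ.symm
  convert h using 1
  ext x k
  have := MeasurableEquiv.piCongrLeft_apply_apply σ.symm (β := fun _ : Fin K => ℝ) x (σ k)
  rw [← this, Equiv.symm_apply_apply]

lemma measure_topSet_subset_eq (ν : Measure ℝ) [IsProbabilityMeasure ν] {T T' : Finset (Fin K)}
    (h : T.card = T'.card) :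
    (Measure.pi fun _ : Fin K => ν).real {x | topSet M x ⊆ T'} =
      (Measure.pi fun _ : Fin K => ν).real {x | topSet M x ⊆ T} := by
  obtain ⟨σ, hσ⟩ := exists_perm_map_eq h
  rw [← (measurePreserving_comp_perm ν σ).measureReal_preimage
    (measurableSet_topSet_subset T).nullMeasurableSet]
  congr 1
  ext x
  simp only [Set.mem_preimage, Set.mem_ofPred_eq]
  rw [topSet_comp_subset_iff, hσ]

/-- Because of ties `S` may have more than `M` elements; it suffices to fix `M` of them and choose
the rest of `T` freely. -/
lemma card_filter_superset_le (S : Finset (Fin K)) {τ : ℕ} (hS : M ≤ S.card) :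
    ((Finset.powersetCard τ Finset.univ).filter fun T : Finset (Fin K) => S ⊆ T).card ≤
      if M ≤ τ then (K - M).choose (τ - M) else 0 := by
  split_ifs with hτ
  · obtain ⟨S₀, hS₀, hcard⟩ := Finset.exists_subset_card_eq hS
    have : (K - M).choose (τ - M) = (Finset.powersetCard (τ - M) S₀ᶜ).card := by
      rw [Finset.card_powersetCard, Finset.card_compl, Fintype.card_fin, hcard]
    rw [this]
    refine Finset.card_le_card_of_injOn (fun T => T \ S₀) (fun T hT => ?_) fun T hT T' hT' h => ?_
    · simp only [Finset.coe_filter, Finset.mem_powersetCard, Set.mem_ofPred_eq] at hT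
      simp only [Finset.mem_coe,
        Finset.mem_powersetCard]
      refine ⟨fun k hk => ?_, ?_⟩
      · simpa using (Finset.mem_sdiff.1 hk).2
      · rw [Finset.card_sdiff_of_subset (hS₀.trans hT.2), hT.1.2, hcard]
    · simp only [Finset.coe_filter, Finset.mem_powersetCard, Set.mem_ofPred_eq] at hT hT'
      rw [← Finset.sdiff_union_of_subset (hS₀.trans hT.2),
        ← Finset.sdiff_union_of_subset (hS₀.trans hT'.2)]
      exact congrArg (· ∪ S₀) h
  · rw [Nat.le_zero, Finset.card_eq_zero, Finset.filter_eq_empty_iff]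
    intro T hT hST
    have := Finset.card_le_card hST
    rw [(Finset.mem_powersetCard.1 hT).2] at this
    omega

/-- The quotient of the binomials is the product of `(τ - i) / (K - i)` over `i < M`, and each
factor is at most `τ / K`. -/
lemma choose_sub_sub_le {K τ : ℕ} (hτ : τ ≤ K) :
    ∀ M, M ≤ τ → ((K - M).choose (τ - M) : ℝ) ≤ K.choose τ * (τ / K : ℝ) ^ M
  | 0, _ => by simp
  | M + 1, hM => by
    have ih := choose_sub_sub_le hτ M (by omega)
    have hK : (0 : ℝ) < K := by exact_mod_cast (show 0 < K by omega)
    have h1 := Nat.add_one_mul_choose_eq (K - (M + 1)) (τ - (M + 1))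
    rw [show K - (M + 1) + 1 = K - M by omega,
      show τ - (M + 1) + 1 = τ - M by omega] at h1
    have h2 : ((K : ℝ) - M) * ((K - (M + 1)).choose (τ - (M + 1)) : ℝ)
        = (K - M).choose (τ - M) * ((τ : ℝ) - M) := by
      rw [← Nat.cast_sub (by omega), ← Nat.cast_sub (by omega)]
      exact_mod_cast h1
    have hKM : (0 : ℝ) < (K : ℝ) - M := by
      rw [sub_pos]; exact_mod_cast (show M < K by omega)
    have hτK : (τ : ℝ) ≤ K := by exact_mod_cast hτ
    have h3 : ((τ : ℝ) - M) / (K - M) ≤ τ / K := by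
      rw [div_le_div_iff₀ hKM hK]
      nlinarith [Nat.cast_nonneg (α := ℝ) M]
    calc ((K - (M + 1)).choose (τ - (M + 1)) : ℝ)
        = (K - M).choose (τ - M) * (((τ : ℝ) - M) / (K - M)) := by
          rw [mul_div_assoc', eq_div_iff hKM.ne', ← h2]; ring
      _ ≤ (K - M).choose (τ - M) * (τ / K) := by gcongr
      _ ≤ K.choose τ * (τ / K : ℝ) ^ M * (τ / K) := by gcongr
      _ = _ := by rw [pow_succ]; ring

/-- By exchangeability, the best channels lie in a given set with the probability that a uniformly
chosen set does. -/
lemma measure_topSet_subset_le (ν : Measure ℝ) [IsProbabilityMeasure ν] (hM : M ≤ K)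
    (T : Finset (Fin K)) :
    (Measure.pi fun _ : Fin K => ν).real {x | topSet M x ⊆ T} ≤ (T.card / K : ℝ) ^ M := by
  classical
  set π := Measure.pi fun _ : Fin K => ν
  set τ := T.card with hτdef
  have hτ : τ ≤ K := by simpa using T.card_le_univ
  -- Double counting: the probability is the same for all sets of size `τ`, and its sum over them is
  -- the expected number of such sets that contain the top set.
  have hsum : (K.choose τ : ℝ) * π.real {x | topSet M x ⊆ T}
      ≤ if M ≤ τ then ((K - M).choose (τ - M) : ℝ) else 0 := by
    calc (K.choose τ : ℝ) * π.real {x | topSet M x ⊆ T}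
        = ∑ T' ∈ Finset.powersetCard τ (Finset.univ : Finset (Fin K)),
            π.real {x | topSet M x ⊆ T'} := by
          rw [Finset.sum_congr rfl fun T' hT' => measure_topSet_subset_eq ν
            (hτdef.symm.trans (Finset.mem_powersetCard.1 hT').2.symm)]
          simp [π]
      _ = ∑ T' ∈ Finset.powersetCard τ (Finset.univ : Finset (Fin K)),
            ∫ x, Set.indicator {x | topSet M x ⊆ T'} (fun _ => (1 : ℝ)) x ∂π := by
          refine Finset.sum_congr rfl fun T' _ => ?_
          exact (integral_indicator_one (measurableSet_topSet_subset T')).symm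
      _ = ∫ x, ∑ T' ∈ Finset.powersetCard τ (Finset.univ : Finset (Fin K)),
            Set.indicator {x | topSet M x ⊆ T'} (fun _ => (1 : ℝ)) x ∂π := by
          rw [integral_finsetSum]
          exact fun T' _ => (integrable_const 1).indicator (measurableSet_topSet_subset T')
      _ ≤ ∫ _, (if M ≤ τ then ((K - M).choose (τ - M) : ℝ) else 0) ∂π := by
          refine integral_mono (integrable_finsetSum _ fun T' _ =>
            (integrable_const 1).indicator (measurableSet_topSet_subset T'))
            (integrable_const _) fun x => ?_
          have := card_filter_superset_le (topSet M x) (τ := τ) (le_card_topSet hM x)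
          have h2 : ∑ T' ∈ Finset.powersetCard τ (Finset.univ : Finset (Fin K)),
              Set.indicator {x | topSet M x ⊆ T'} (fun _ => (1 : ℝ)) x =
              (((Finset.powersetCard τ Finset.univ).filter
                fun T' : Finset (Fin K) => topSet M x ⊆ T').card : ℝ) := by
            rw [Finset.card_filter]
            push_cast
            refine Finset.sum_congr rfl fun T' _ => ?_
            simp [Set.indicator_apply]
          simp only [h2]
          exact_mod_cast this
      _ = _ := by simp
  have hpos : (0 : ℝ) < K.choose τ := by exact_mod_cast Nat.choose_pos hτ
  refine le_of_mul_le_mul_left (hsum.trans ?_) hpos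
  split_ifs with h
  · exact choose_sub_sub_le hτ M h
  · positivity

/-- An inequality is enough for union bounds and spares the measurability of `B`. -/
lemma measure_eval_le {ν : Fin N → Measure ℝ} [∀ n, IsProbabilityMeasure (ν n)] (n : Fin N)
    (B : Set (Fin K → ℝ)) :
    (Measure.pi fun n => Measure.pi fun _ : Fin K => ν n).real {h | h n ∈ B} ≤
      (Measure.pi fun _ : Fin K => ν n).real B := by
  have hp := measurePreserving_eval (fun n => Measure.pi fun _ : Fin K => ν n) n
  rw [measureReal_def, measureReal_def]
  refine ENNReal.toReal_mono (measure_ne_top _ _) ?_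
  conv_rhs => rw [← hp.map_eq]
  exact Measure.le_map_apply hp.measurable.aemeasurable B

/-- Union bound for the failure of Hall's condition. -/
lemma measure_not_hall_le {ν : Fin N → Measure ℝ} [∀ n, IsProbabilityMeasure (ν n)]
    (hM : M ≤ b * N) (τ : ℕ → ℕ)
    (hτ : ∀ s ∈ Finset.Icc 1 N, b * s ≤ τ s + 1 ∧ τ s ≤ b * N) :
    (Measure.pi fun n => Measure.pi fun _ : Fin (b * N) => ν n).real
      {h | ¬ ∀ S : Finset (Fin N), b * S.card ≤ (S.biUnion fun n => topSet M (h n)).card} ≤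
      ∑ s ∈ Finset.Icc 1 N, (N.choose s : ℝ) * ((b * N).choose (τ s) : ℝ) *
        (τ s / (b * N : ℕ) : ℝ) ^ (M * s) := by
  classical
  set Q := Measure.pi fun n => Measure.pi fun _ : Fin (b * N) => ν n
  have hsub : {h : Fin N → Fin (b * N) → ℝ |
      ¬ ∀ S : Finset (Fin N), b * S.card ≤ (S.biUnion fun n => topSet M (h n)).card} ⊆
      ⋃ s ∈ Finset.Icc 1 N, ⋃ S ∈ Finset.powersetCard s (Finset.univ : Finset (Fin N)),
        ⋃ T ∈ Finset.powersetCard (τ s) (Finset.univ : Finset (Fin (b * N))),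
          {h : Fin N → Fin (b * N) → ℝ | ∀ n ∈ S, topSet M (h n) ⊆ T} := by
    intro h hh
    simp only [Set.mem_ofPred_eq, not_forall, not_le] at hh
    obtain ⟨S, hS⟩ := hh
    have hs : S.card ∈ Finset.Icc 1 N := by
      rw [Finset.mem_Icc]
      refine ⟨Nat.one_le_iff_ne_zero.2 fun h0 => ?_, by simpa using S.card_le_univ⟩
      rw [h0] at hS
      omega
    obtain ⟨h1, h2⟩ := hτ _ hs
    -- The violating union has at most `b * S.card - 1 ≤ τ S.card` elements, so it can be enlarged
    -- to exactly `τ S.card`.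
    obtain ⟨T, hT, -, hTc⟩ := Finset.exists_subsuperset_card_eq
      (Finset.subset_univ (S.biUnion fun n => topSet M (h n))) (n := τ S.card) (by omega)
      (by simpa using h2)
    simp only [Set.mem_iUnion]
    exact ⟨S.card, hs, S, by simp, T, by simp [hTc], fun n hn =>
      (Finset.subset_biUnion_of_mem (fun n => topSet M (h n)) hn).trans hT⟩
  -- The users are independent, so the event is a box and its probability a product over `S`.
  have hcell : ∀ (S : Finset (Fin N)) (T : Finset (Fin (b * N))),
      Q.real {h | ∀ n ∈ S, topSet M (h n) ⊆ T} ≤ (T.card / (b * N : ℕ) : ℝ) ^ (M * S.card) := by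
    intro S T
    have : {h : Fin N → Fin (b * N) → ℝ | ∀ n ∈ S, topSet M (h n) ⊆ T} =
        Set.pi Set.univ fun n => if n ∈ S then {x | topSet M x ⊆ T} else Set.univ := by
      ext h
      simp only [Set.mem_ofPred_eq, Set.mem_pi, Set.mem_univ, true_imp_iff]
      refine forall_congr' fun n => ?_
      split_ifs with hn <;> simp [hn]
    rw [this, measureReal_def, Measure.pi_pi, ENNReal.toReal_prod]
    calc ∏ n, ((Measure.pi fun _ : Fin (b * N) => ν n)
          (if n ∈ S then {x | topSet M x ⊆ T} else Set.univ)).toReal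
        ≤ ∏ n, (if n ∈ S then (T.card / (b * N : ℕ) : ℝ) ^ M else 1) := by
          refine Finset.prod_le_prod (fun n _ => ENNReal.toReal_nonneg) fun n _ => ?_
          split_ifs with hn
          · exact measure_topSet_subset_le (ν n) hM T
          · simp
      _ = _ := by simp [pow_mul]
  refine (measureReal_mono hsub (measure_ne_top _ _)).trans ((measureReal_biUnion_finset_le _ _).trans
    (Finset.sum_le_sum fun s _ => ?_))
  refine (measureReal_biUnion_finset_le _ _).trans ((Finset.sum_le_card_nsmul _ _
    (((b * N).choose (τ s) : ℝ) * (τ s / (b * N : ℕ) : ℝ) ^ (M * s)) fun S hS => ?_).trans_eq ?_)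
  · refine (measureReal_biUnion_finset_le _ _).trans ((Finset.sum_le_card_nsmul _ _
      ((τ s / (b * N : ℕ) : ℝ) ^ (M * s)) fun T hT => ?_).trans_eq ?_)
    · have := hcell S T
      rwa [(Finset.mem_powersetCard.1 hS).2, (Finset.mem_powersetCard.1 hT).2] at this
    · simp
  · simp [mul_assoc]

/-- If fewer than `M` gains exceed `l`, then all gains outside some set of `M` channels are at most
`l`. -/
lemma measure_card_lt_le (ν : Measure ℝ) [IsProbabilityMeasure ν] (hM : M ≤ K) (l : ℝ) :
    (Measure.pi fun _ : Fin K => ν).real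
      {x | (Finset.univ.filter fun j => l < x j).card < M} ≤
      (K.choose M : ℝ) * ν.real (Set.Iic l) ^ (K - M) := by
  classical
  set π := Measure.pi fun _ : Fin K => ν
  have hsub : {x : Fin K → ℝ | (Finset.univ.filter fun j => l < x j).card < M} ⊆
      ⋃ T ∈ Finset.powersetCard M (Finset.univ : Finset (Fin K)),
        Set.pi Set.univ fun k => if k ∈ T then Set.univ else Set.Iic l := by
    intro x hx
    obtain ⟨T, hT, -, hTc⟩ := Finset.exists_subsuperset_card_eq
      (Finset.subset_univ (Finset.univ.filter fun j => l < x j)) (n := M) (le_of_lt hx)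
      (by simpa using hM)
    simp only [Set.mem_iUnion]
    refine ⟨T, by simp [hTc], fun k _ => ?_⟩
    show x k ∈ if k ∈ T then Set.univ else Set.Iic l
    split_ifs with hk
    · trivial
    · by_contra hlt
      exact hk (hT (by simpa using hlt))
  refine (measureReal_mono hsub (measure_ne_top _ _)).trans ((measureReal_biUnion_finset_le _ _).trans
    ((Finset.sum_le_card_nsmul _ _ (ν.real (Set.Iic l) ^ (K - M)) fun T hT => ?_).trans_eq ?_))
  · refine le_of_eq ?_
    rw [measureReal_def, Measure.pi_pi, ENNReal.toReal_prod]
    calc ∏ k, (ν (if k ∈ T then Set.univ else Set.Iic l)).toReal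
        = ∏ k, if k ∈ T then 1 else ν.real (Set.Iic l) := by
          refine Finset.prod_congr rfl fun k _ => ?_
          split_ifs <;> simp [measureReal_def]
      _ = _ := by
          rw [Finset.prod_ite, Finset.prod_const_one, one_mul, Finset.prod_const]
          congr 1
          rw [← (Finset.mem_powersetCard.1 hT).2, Finset.filter_notMem_eq_sdiff,
            ← Finset.compl_eq_univ_sdiff, Finset.card_compl, Fintype.card_fin]
  · simp

lemma measure_exists_card_lt_le {ν : Fin N → Measure ℝ} [∀ n, IsProbabilityMeasure (ν n)]
    (hM : M ≤ K) (l : Fin N → ℝ) :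
    (Measure.pi fun n => Measure.pi fun _ : Fin K => ν n).real
      {h | ∃ n, (Finset.univ.filter fun j => l n < h n j).card < M} ≤
      ∑ n, (K.choose M : ℝ) * (ν n).real (Set.Iic (l n)) ^ (K - M) := by
  rw [Set.ofPred_exists]
  refine (measureReal_iUnion_fintype_le _).trans (Finset.sum_le_sum fun n _ => ?_)
  exact (measure_eval_le n {x : Fin K → ℝ | (Finset.univ.filter fun j => l n < x j).card < M}).trans
    (measure_card_lt_le (ν n) hM (l n))

lemma measure_exists_lt_abs_le {ν : Fin N → Measure ℝ} [∀ n, IsProbabilityMeasure (ν n)]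
    (u : Fin N → ℝ) :
    (Measure.pi fun n => Measure.pi fun _ : Fin K => ν n).real
      {h | ∃ n k, u n < |h n k|} ≤ ∑ n, K * (ν n).real {x | u n < |x|} := by
  rw [Set.ofPred_exists]
  refine (measureReal_iUnion_fintype_le _).trans (Finset.sum_le_sum fun n _ => ?_)
  rw [Set.ofPred_exists]
  refine (measureReal_iUnion_fintype_le _).trans ?_
  refine (Finset.sum_le_card_nsmul _ _ ((ν n).real {x | u n < |x|}) fun k _ => ?_).trans_eq
    (by simp)
  refine (measure_eval_le n {x : Fin K → ℝ | u n < |x k|}).trans_eq ?_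
  exact (measurePreserving_eval (fun _ : Fin K => ν n) k).measureReal_preimage
    (measurableSet_lt measurable_const measurable_id.abs).nullMeasurableSet

end Probability

/-! ### Estimates of the terms in the Hall union bound -/

section HallBound

lemma choose_mul_div_pow_le_exp {n : ℕ} (hn : 0 < n) (k : ℕ) :
    (n.choose k : ℝ) * (k / n : ℝ) ^ k ≤ Real.exp k := by
  have hn' : (0 : ℝ) < n := by exact_mod_cast hn
  calc (n.choose k : ℝ) * (k / n : ℝ) ^ k ≤ (n ^ k / k.factorial : ℝ) * (k / n : ℝ) ^ k := by
        gcongr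
        exact Nat.choose_le_pow_div k n
    _ = (k : ℝ) ^ k / k.factorial := by
        rw [div_pow]
        field_simp
    _ ≤ Real.exp k := Real.pow_div_factorial_le_exp _ (Nat.cast_nonneg k) k

variable {N b M s : ℕ} {δ ε : ℝ}

/-- Of the `M` factors `(s / N) ^ s`, `1 + b` cancel the two binomials up to `exp ((1 + b) s)`; each
of the others is at most `(1 - δ) ^ s`. -/
lemma hall_term_le_of_small (hb : 1 ≤ b) (hN : 1 ≤ N) (hM : 1 + b ≤ M)
    (hs : (s : ℝ) ≤ (1 - δ) * N) :
    (N.choose s : ℝ) * ((b * N).choose (b * s) : ℝ) *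
      ((b * s : ℕ) / (b * N : ℕ) : ℝ) ^ (M * s) ≤
      (Real.exp (1 + b) * (1 - δ) ^ (M - 1 - b)) ^ s := by
  have hb' : (0 : ℝ) < b := by exact_mod_cast hb
  have hN' : (0 : ℝ) < N := by exact_mod_cast hN
  have hratio : ((b * s : ℕ) / (b * N : ℕ) : ℝ) = s / N := by
    push_cast
    field_simp
  have h1 := choose_mul_div_pow_le_exp hN s
  have h2 := choose_mul_div_pow_le_exp (Nat.mul_pos hb hN) (b * s)
  have h3 : (s / N : ℝ) ≤ 1 - δ := by rwa [div_le_iff₀ hN']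
  rw [hratio] at h2 ⊢
  obtain ⟨m, rfl⟩ : ∃ m, M = m + 1 + b := ⟨M - 1 - b, by omega⟩
  rw [show m + 1 + b - 1 - b = m by omega]
  calc (N.choose s : ℝ) * ((b * N).choose (b * s) : ℝ) * (s / N : ℝ) ^ ((m + 1 + b) * s)
      = ((N.choose s : ℝ) * (s / N : ℝ) ^ s) *
        (((b * N).choose (b * s) : ℝ) * (s / N : ℝ) ^ (b * s)) * ((s / N : ℝ) ^ m) ^ s := by
        rw [← pow_mul]; ring
    _ ≤ Real.exp s * Real.exp ((b * s : ℕ) : ℝ) * ((1 - δ) ^ m) ^ s := by gcongr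
    _ = (Real.exp (1 + b) * (1 - δ) ^ m) ^ s := by
        rw [mul_pow, ← Real.exp_nat_mul, ← Real.exp_add]
        congr 2
        push_cast
        ring

/-- With `t = N - s`, the binomials are at most `K ^ t` and `K ^ (b t + 1)`, and the power is at
most `exp (-(b t + 1) M s / K)`. Since `s / K ≥ (1 - δ) / b`, the size of `M` makes the last
exponent win by `(ε / 2) L (t + 1)`. -/
lemma hall_term_le_of_large (hb : 1 ≤ b) (hs1 : 1 ≤ s) (hsN : s ≤ N) (hε : 0 < ε)
    (hδ : (1 + ε) * (1 - δ) = 1 + ε / 2)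
    (hM : ((b : ℝ) + 1) * (1 + ε) * Real.log (b * N : ℕ) ≤ M) (hs : (1 - δ) * N ≤ s) :
    (N.choose s : ℝ) * ((b * N).choose (b * s - 1) : ℝ) *
      ((b * s - 1 : ℕ) / (b * N : ℕ) : ℝ) ^ (M * s) ≤
      Real.exp (-(ε / 2 * Real.log (b * N : ℕ))) ^ (N + 1 - s) := by
  obtain ⟨t, rfl⟩ : ∃ t, N = s + t := ⟨N - s, by omega⟩
  have hb' : (1 : ℝ) ≤ b := by exact_mod_cast hb
  have hbs : 1 ≤ b * s := Nat.mul_pos hb hs1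
  set K : ℕ := b * (s + t) with hK
  have hKst : s + t ≤ K := Nat.le_mul_of_pos_left _ hb
  have hK1 : (1 : ℝ) ≤ K := by exact_mod_cast (show 1 ≤ K by omega)
  have hK0 : (0 : ℝ) < K := by linarith
  set L := Real.log K with hL
  have hL0 : 0 ≤ L := Real.log_nonneg hK1
  have hKexp : (K : ℝ) = Real.exp L := (Real.exp_log hK0).symm
  have h1 : ((s + t).choose s : ℝ) ≤ (K : ℝ) ^ t := by
    rw [Nat.choose_symm_add]
    calc ((s + t).choose t : ℝ) ≤ ((s + t : ℕ) : ℝ) ^ t := by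
          exact_mod_cast Nat.choose_le_pow (s + t) t
      _ ≤ (K : ℝ) ^ t := by gcongr
  have hKsub : K = (b * s - 1) + (b * t + 1) := by rw [hK, Nat.mul_add]; omega
  have h2 : (K.choose (b * s - 1) : ℝ) ≤ (K : ℝ) ^ (b * t + 1) := by
    have : K.choose (b * s - 1) = K.choose (b * t + 1) := by
      conv_lhs => rw [hKsub]
      conv_rhs => rw [hKsub]
      exact Nat.choose_symm_add
    rw [this]
    exact_mod_cast Nat.choose_le_pow K (b * t + 1)
  have h3 : ((b * s - 1 : ℕ) / K : ℝ) ≤ Real.exp (-((b * t + 1) / K)) := by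
    have : ((b * s - 1 : ℕ) / K : ℝ) = 1 - (b * t + 1) / K := by
      rw [eq_sub_iff_add_eq, ← add_div, div_eq_one_iff_eq hK0.ne']
      exact_mod_cast hKsub.symm
    rw [this]
    exact Real.one_sub_le_exp_neg _
  have hKb : (K : ℝ) = b * (s + t : ℕ) := by rw [hK]; push_cast; ring
  have hMs : ((b : ℝ) + 1) * (1 + ε / 2) * L ≤ b * (M * s / K) := by
    have e1 : (1 - δ) * ((s + t : ℕ) : ℝ) ≤ s := hs
    have hst : (0 : ℝ) < ((s + t : ℕ) : ℝ) := by exact_mod_cast (show 0 < s + t by omega)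
    have hδ' : 0 ≤ 1 - δ := by
      by_contra! h
      nlinarith
    calc ((b : ℝ) + 1) * (1 + ε / 2) * L = (((b : ℝ) + 1) * (1 + ε) * L) * (1 - δ) := by
          rw [← hδ]; ring
      _ ≤ M * (1 - δ) := by gcongr
      _ ≤ M * (s / (s + t : ℕ)) := by
          gcongr
          rwa [le_div_iff₀ hst]
      _ = b * (M * s / K) := by
          rw [hKb]
          field_simp
  have hexp : (t : ℝ) * L + (b * t + 1) * L - (b * t + 1) * (M * s / K) ≤
      -(ε / 2 * L) * (t + 1) := by
    have e2 : ((b : ℝ) * t + 1) * (((b : ℝ) + 1) * (1 + ε / 2) * L) ≤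
        (b * t + 1) * (b * (M * s / K)) := by gcongr
    -- This is `b ((b + 1) t + 1) ≤ (b t + 1)(b + 1)`, whose sides differ by 1; the factor `b + 1`
    -- in `M` is what makes it hold for all `t`.
    have e3 : b * ((((b : ℝ) + 1) * t + 1) * ((1 + ε / 2) * L)) ≤
        ((b : ℝ) * t + 1) * (((b : ℝ) + 1) * (1 + ε / 2) * L) := by
      have : 0 ≤ (1 + ε / 2) * L := by positivity
      nlinarith
    have e4 : (((b : ℝ) + 1) * t + 1) * ((1 + ε / 2) * L) ≤ (b * t + 1) * (M * s / K) := by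
      refine le_of_mul_le_mul_left ?_ (show (0 : ℝ) < b by linarith)
      linarith
    have e5 : (ε / 2 * L) * (t + 1) ≤ (ε / 2 * L) * (((b : ℝ) + 1) * t + 1) := by
      gcongr
      nlinarith [Nat.cast_nonneg (α := ℝ) t]
    linarith
  calc ((s + t).choose s : ℝ) * (K.choose (b * s - 1) : ℝ) *
        ((b * s - 1 : ℕ) / K : ℝ) ^ (M * s)
      ≤ (K : ℝ) ^ t * (K : ℝ) ^ (b * t + 1) * (Real.exp (-((b * t + 1) / K))) ^ (M * s) := by
        gcongr
    _ = Real.exp ((t : ℝ) * L + (b * t + 1) * L - (b * t + 1) * (M * s / K)) := by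
        rw [hKexp, ← Real.exp_nat_mul, ← Real.exp_nat_mul, ← Real.exp_nat_mul, ← Real.exp_add,
          ← Real.exp_add]
        congr 1
        push_cast
        ring
    _ ≤ Real.exp (-(ε / 2 * L) * (t + 1)) := Real.exp_le_exp.2 hexp
    _ = _ := by
        rw [show s + t + 1 - s = t + 1 by omega, ← Real.exp_nat_mul]
        congr 1
        push_cast
        ring

lemma sum_Icc_pow_le {q : ℝ} (hq : 0 ≤ q) (hq2 : q ≤ 1 / 2) (N : ℕ) :
    ∑ s ∈ Finset.Icc 1 N, q ^ s ≤ 2 * q := by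
  have h1 : ∑ s ∈ Finset.Icc 1 N, q ^ s = ∑ i ∈ Finset.range N, q * q ^ i := by
    induction N with
    | zero => simp
    | succ N ih => rw [Finset.sum_Icc_succ_top (by omega), ih, Finset.sum_range_succ, pow_succ']
  rw [h1, ← Finset.mul_sum, mul_comm 2 q]
  gcongr
  calc ∑ i ∈ Finset.range N, q ^ i ≤ ∑ i ∈ Finset.range N, (1 / 2 : ℝ) ^ i := by gcongr
    _ ≤ 2 := sum_geometric_two_le N

lemma sum_Icc_pow_reflect (r : ℝ) (N : ℕ) :
    ∑ s ∈ Finset.Icc 1 N, r ^ (N + 1 - s) = ∑ s ∈ Finset.Icc 1 N, r ^ s := by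
  refine Finset.sum_nbij' (fun s => N + 1 - s) (fun s => N + 1 - s) ?_ ?_ ?_ ?_ ?_ <;>
    intro s hs <;> simp only [Finset.mem_Icc] at * <;> omega

/-- In a random graph in which every user chooses `M` channels, Hall's condition holds with high
probability. -/
lemma measure_not_hall_le_geometric {ν : Fin N → Measure ℝ} [∀ n, IsProbabilityMeasure (ν n)]
    (hb : 1 ≤ b) (hN : 1 ≤ N) (hε : 0 < ε) (hδ1 : δ ≤ 1)
    (hδ : (1 + ε) * (1 - δ) = 1 + ε / 2) (hMK : M ≤ b * N) (hMb : 1 + b ≤ M)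
    (hM : ((b : ℝ) + 1) * (1 + ε) * Real.log (b * N : ℕ) ≤ M)
    (hq : Real.exp (1 + b) * (1 - δ) ^ (M - 1 - b) ≤ 1 / 2)
    (hr : Real.exp (-(ε / 2 * Real.log (b * N : ℕ))) ≤ 1 / 2) :
    (Measure.pi fun n => Measure.pi fun _ : Fin (b * N) => ν n).real
      {h | ¬ ∀ S : Finset (Fin N), b * S.card ≤ (S.biUnion fun n => topSet M (h n)).card} ≤
      2 * (Real.exp (1 + b) * (1 - δ) ^ (M - 1 - b)) +
        2 * Real.exp (-(ε / 2 * Real.log (b * N : ℕ))) := by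
  classical
  have hq0 : 0 ≤ Real.exp (1 + b) * (1 - δ) ^ (M - 1 - b) :=
    mul_nonneg (Real.exp_pos _).le (pow_nonneg (by linarith) _)
  refine (measure_not_hall_le hMK
    -- For small `s` the size `b s` gives the clean ratio `s / N`. Near `s = N` the `- 1` is
    -- essential: at `s = N` the ratio would otherwise be 1.
    (fun s => if (s : ℝ) ≤ (1 - δ) * N then b * s else b * s - 1) fun s hs => ?_).trans ?_
  · have := Nat.mul_le_mul_left b (Finset.mem_Icc.1 hs).2
    split_ifs <;> omega
  calc _ ≤ ∑ s ∈ Finset.Icc 1 N, ((Real.exp (1 + b) * (1 - δ) ^ (M - 1 - b)) ^ s +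
        Real.exp (-(ε / 2 * Real.log (b * N : ℕ))) ^ (N + 1 - s)) := by
        refine Finset.sum_le_sum fun s hs => ?_
        obtain ⟨hs1, hsN⟩ := Finset.mem_Icc.1 hs
        split_ifs with h
        · exact (hall_term_le_of_small hb hN hMb h).trans
            (le_add_of_nonneg_right (by positivity))
        · exact (hall_term_le_of_large hb hs1 hsN hε hδ hM (le_of_not_ge h)).trans
            (le_add_of_nonneg_left (pow_nonneg hq0 _))
    _ ≤ _ := by
        rw [Finset.sum_add_distrib, sum_Icc_pow_reflect]
        exact add_le_add (sum_Icc_pow_le hq0 hq N) (sum_Icc_pow_le (Real.exp_pos _).le hr N)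

end HallBound

/-! ### Tails and rates at the scale of powers of `log K` -/

section Tails

variable {ν : ℕ → Measure ℝ} {α β lam γ : ℕ → ℝ}

lemma tailProfile_rpow_inv {a β' l' γ' y : ℝ} (hy : 0 ≤ y) (hγ : 0 < γ') :
    tailProfile a β' l' γ' (y ^ (1 / γ')) = a * y ^ (β' / γ') * Real.exp (-(l' * y)) := by
  unfold tailProfile
  rw [← Real.rpow_mul hy, ← Real.rpow_mul hy, one_div_mul_cancel hγ.ne', Real.rpow_one,
    one_div_mul_eq_div, neg_mul]

lemma eventually_const_mul_rpow_le_exp (B A D : ℝ) {κ : ℝ} (hκ : 0 < κ) (hA : 0 < A) :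
    ∀ᶠ L : ℝ in atTop, B * (A * L) ^ D ≤ Real.exp (κ * L) := by
  have h1 := (isLittleO_rpow_exp_pos_mul_atTop D hκ).const_mul_left (B * A ^ D)
  filter_upwards [h1.bound one_pos, eventually_ge_atTop 0] with L hL hL0
  rw [one_mul, Real.norm_eq_abs, Real.norm_eq_abs, Real.abs_exp] at hL
  rw [Real.mul_rpow hA.le hL0, ← mul_assoc]
  exact (le_abs_self _).trans hL

/-- At `x = (A L) ^ (1 / γ n)` the exponential factor is `exp (-lam n A L)`. The rest is a power of
`A L` with exponent at most `C / c` in absolute value, times bounded constants, and is absorbed by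
`exp (± κ L)` uniformly in `n`. -/
lemma UniformExpDominatedTail.eventually_tail_mem_Icc (h : UniformExpDominatedTail ν α β lam γ)
    {A κ : ℝ} (hA : 0 < A) (hκ : 0 < κ) :
    ∀ᶠ L : ℝ in atTop, ∀ n, 1 - cdf (ν n) ((A * L) ^ (1 / γ n)) ∈
      Set.Icc (Real.exp (-((lam n * A + κ) * L))) (Real.exp (-((lam n * A - κ) * L))) := by
  obtain ⟨c, C, hc, hbd⟩ := h.bounds
  have hC : 0 < C := hc.trans_le ((hbd 0).1.1.trans (hbd 0).1.2)
  have hAL : Tendsto (fun L : ℝ => A * L) atTop atTop := tendsto_id.const_mul_atTop hA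
  obtain ⟨X, hX⟩ := eventually_atTop.1
    (Metric.tendstoUniformly_iff.1 h.uniform (1 / 2) (by norm_num))
  -- As `γ n ≤ C`, this puts all the points `(A L) ^ (1 / γ n)` beyond `X` at once when `A L ≥ 1`.
  have hlarge : ∀ᶠ L : ℝ in atTop, X ≤ (A * L) ^ (1 / C) :=
    ((tendsto_rpow_atTop (by positivity)).comp hAL).eventually_ge_atTop X
  filter_upwards [hlarge, hAL.eventually_ge_atTop 1,
    eventually_const_mul_rpow_le_exp (3 / 2 * C) A (C / c) hκ hA,
    eventually_const_mul_rpow_le_exp (2 / c) A (C / c) hκ hA] with L hL1 hL2 hL3 hL4 n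
  obtain ⟨hα, hβ, hlam, hγ⟩ := hbd n
  have hγ0 : 0 < γ n := hc.trans_le hγ.1
  have hα0 : 0 < α n := hc.trans_le hα.1
  set y := A * L
  have hy0 : 0 < y := by linarith
  have hx : X ≤ y ^ (1 / γ n) := hL1.trans (Real.rpow_le_rpow_of_exponent_le hL2
    (one_div_le_one_div_of_le hγ0 hγ.2))
  have hratio := hX _ hx n
  have hβγ : |β n / γ n| ≤ C / c := by
    rw [abs_div, abs_of_pos hγ0]
    exact div_le_div₀ hC.le (abs_le.2 hβ) hc hγ.1
  rw [abs_le] at hβγ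
  have hprof : 0 < tailProfile (α n) (β n) (lam n) (γ n) (y ^ (1 / γ n)) := by
    rw [tailProfile_rpow_inv hy0.le hγ0]
    positivity
  rw [Real.dist_eq, abs_lt, tailRatio] at hratio
  have hlo : 1 / 2 * tailProfile (α n) (β n) (lam n) (γ n) (y ^ (1 / γ n)) ≤
      1 - cdf (ν n) (y ^ (1 / γ n)) := by
    rw [← le_div_iff₀ hprof]
    linarith
  have hhi : 1 - cdf (ν n) (y ^ (1 / γ n)) ≤
      3 / 2 * tailProfile (α n) (β n) (lam n) (γ n) (y ^ (1 / γ n)) := by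
    rw [← div_le_iff₀ hprof]
    linarith
  rw [tailProfile_rpow_inv hy0.le hγ0] at hlo hhi
  constructor
  · refine le_trans ?_ hlo
    have hyD : 0 < y ^ (C / c) := Real.rpow_pos_of_pos hy0 _
    have h1 : y ^ (-(C / c)) ≤ y ^ (β n / γ n) := Real.rpow_le_rpow_of_exponent_le hL2 hβγ.1
    have h2 : Real.exp (-(κ * L)) ≤ 1 / 2 * (c * y ^ (-(C / c))) := by
      rw [Real.exp_neg, Real.rpow_neg hy0.le]
      refine (inv_anti₀ (by positivity) hL4).trans_eq ?_
      field_simp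
    calc Real.exp (-((lam n * A + κ) * L))
        = Real.exp (-(κ * L)) * Real.exp (-(lam n * y)) := by
          rw [← Real.exp_add]
          congr 1
          ring
      _ ≤ 1 / 2 * (α n * y ^ (β n / γ n)) * Real.exp (-(lam n * y)) := by
          gcongr
          refine h2.trans ?_
          have := hα.1
          gcongr
      _ = _ := by ring
  · refine hhi.trans ?_
    have h1 : y ^ (β n / γ n) ≤ y ^ (C / c) := Real.rpow_le_rpow_of_exponent_le hL2 hβγ.2
    calc 3 / 2 * (α n * y ^ (β n / γ n) * Real.exp (-(lam n * y)))
        ≤ 3 / 2 * (C * y ^ (C / c) * Real.exp (-(lam n * y))) := by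
          have := hα.2
          gcongr
      _ ≤ Real.exp (κ * L) * Real.exp (-(lam n * y)) := by
          rw [← mul_assoc, ← mul_assoc]
          gcongr
      _ = Real.exp (-((lam n * A - κ) * L)) := by
          rw [← Real.exp_add]
          congr 1
          ring

/-- The logarithm equals `(2 / γ) log L` plus a term bounded uniformly for `γ` in `[c, C]`, so `c₀`
and `A` do not matter to leading order. -/
lemma eventually_logb_mem_Icc {c₀ A c C η : ℝ} (hc₀ : 0 < c₀) (hA : 0 < A) (hc : 0 < c)
    (hC : 0 < C) (hη : 0 < η) :
    ∀ᶠ L : ℝ in atTop, ∀ γ ∈ Set.Icc c C,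
      Real.logb 2 (1 + c₀ * ((A * L) ^ (1 / γ)) ^ 2) ∈
        Set.Icc ((1 - η) * (2 / γ * Real.logb 2 L)) ((1 + η) * (2 / γ * Real.logb 2 L)) := by
  have h2 : (0 : ℝ) < Real.log 2 := Real.log_pos (by norm_num)
  have hlog : ∀ᶠ L : ℝ in atTop,
      2 / c * |Real.log A| + |Real.log c₀| + Real.log (1 + c₀) ≤ η * (2 / C) * Real.log L :=
    (Real.tendsto_log_atTop.const_mul_atTop (by positivity)).eventually_ge_atTop _
  have hAL : Tendsto (fun L : ℝ => A * L) atTop atTop := tendsto_id.const_mul_atTop hA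
  filter_upwards [hlog, eventually_ge_atTop 1, hAL.eventually_ge_atTop 1] with L hL hL1 hAL1 γ hγ
  have hγ0 : 0 < γ := hc.trans_le hγ.1
  have hL0 : 0 < L := by linarith
  have hAL0 : 0 < A * L := by linarith
  have hy : ((A * L) ^ (1 / γ)) ^ 2 = (A * L) ^ (2 / γ) := by
    rw [← Real.rpow_natCast, ← Real.rpow_mul hAL0.le]
    congr 1
    push_cast
    ring
  have hlogy : Real.log ((A * L) ^ (2 / γ)) = 2 / γ * Real.log A + 2 / γ * Real.log L := by
    rw [Real.log_rpow hAL0, Real.log_mul hA.ne' hL0.ne']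
    ring
  have hy0 : 0 < (A * L) ^ (2 / γ) := Real.rpow_pos_of_pos hAL0 _
  have hy1 : 1 ≤ (A * L) ^ (2 / γ) := Real.one_le_rpow hAL1 (by positivity)
  have hlogL : 0 ≤ Real.log L := Real.log_nonneg hL1
  have hAbd : |2 / γ * Real.log A| ≤ 2 / c * |Real.log A| := by
    rw [abs_mul, abs_of_pos (show 0 < 2 / γ by positivity)]
    gcongr
    exact hγ.1
  have hCbd : η * (2 / C) * Real.log L ≤ η * (2 / γ) * Real.log L := by
    gcongr
    exact hγ.2
  have hlog1 : 0 ≤ Real.log (1 + c₀) := Real.log_nonneg (by linarith)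
  rw [hy, Real.logb, Real.logb]
  rw [abs_le] at hAbd
  constructor
  · rw [show (1 - η) * (2 / γ * (Real.log L / Real.log 2)) =
      (1 - η) * (2 / γ * Real.log L) / Real.log 2 by ring]
    gcongr
    calc (1 - η) * (2 / γ * Real.log L)
        ≤ Real.log c₀ + Real.log ((A * L) ^ (2 / γ)) := by
          rw [hlogy]
          linarith [neg_abs_le (Real.log c₀)]
      _ = Real.log (c₀ * (A * L) ^ (2 / γ)) := (Real.log_mul hc₀.ne' hy0.ne').symm
      _ ≤ Real.log (1 + c₀ * (A * L) ^ (2 / γ)) := Real.log_le_log (by positivity) (by linarith)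
  · rw [show (1 + η) * (2 / γ * (Real.log L / Real.log 2)) =
      (1 + η) * (2 / γ * Real.log L) / Real.log 2 by ring]
    gcongr
    calc Real.log (1 + c₀ * (A * L) ^ (2 / γ))
        ≤ Real.log ((1 + c₀) * (A * L) ^ (2 / γ)) :=
          Real.log_le_log (by positivity) (by linarith)
      _ = Real.log (1 + c₀) + Real.log ((A * L) ^ (2 / γ)) :=
          Real.log_mul (by positivity) hy0.ne'
      _ ≤ (1 + η) * (2 / γ * Real.log L) := by
          rw [hlogy]
          linarith [abs_nonneg (Real.log c₀)]

end Tails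

/-! ### The good event has probability tending to 1 -/

section Asymptotics

variable {ν : ℕ → Measure ℝ} {α β lam γ : ℕ → ℝ} {b : ℕ} {ε : ℝ}

lemma measureReal_Ioi_eq_one_sub_cdf (m : Measure ℝ) [IsProbabilityMeasure m] (x : ℝ) :
    m.real (Set.Ioi x) = 1 - cdf m x := by
  rw [cdf_eq_real, ← Set.compl_Iic, probReal_compl_eq_one_sub measurableSet_Iic]

lemma tendsto_log_mul_atTop (hb : 1 ≤ b) :
    Tendsto (fun N : ℕ => Real.log (b * N : ℕ)) atTop atTop :=
  Real.tendsto_log_atTop.comp (tendsto_natCast_atTop_atTop.comp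
    (tendsto_id.const_mul_atTop' (show 0 < b by omega)))

lemma le_numBest (K : ℕ) : ((b : ℝ) + 1) * (1 + ε) * Real.log K ≤ numBest b ε K :=
  Nat.le_ceil _

lemma numBest_le (hε : 0 < ε) {K : ℕ} (hK : 1 ≤ K) :
    (numBest b ε K : ℝ) ≤ ((b : ℝ) + 1) * (1 + ε) * Real.log K + 1 :=
  (Nat.ceil_lt_add_one (mul_nonneg (by positivity)
    (Real.log_nonneg (by exact_mod_cast hK)))).le

lemma tendsto_numBest_atTop (hb : 1 ≤ b) (hε : 0 < ε) :
    Tendsto (fun N : ℕ => numBest b ε (b * N)) atTop atTop :=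
  tendsto_nat_ceil_atTop.comp ((tendsto_log_mul_atTop hb).const_mul_atTop (by positivity))

lemma eventually_two_mul_numBest_le (hb : 1 ≤ b) (hε : 0 < ε) :
    ∀ᶠ N : ℕ in atTop, 2 * numBest b ε (b * N) ≤ b * N := by
  have h1 := (tendsto_log_mul_atTop hb).eventually
    (eventually_const_mul_rpow_le_exp (2 * (((b : ℝ) + 1) * (1 + ε) + 1)) 1 1 one_pos one_pos)
  filter_upwards [h1, (tendsto_log_mul_atTop hb).eventually_ge_atTop 1, eventually_ge_atTop 1]
    with N hN hL hN1
  have hK : 1 ≤ b * N := Nat.mul_pos hb hN1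
  have h2 := numBest_le (b := b) hε hK
  simp only [one_mul, Real.rpow_one] at hN
  rw [Real.exp_log (by exact_mod_cast hK)] at hN
  have h3 : (2 * numBest b ε (b * N) : ℝ) ≤ (b * N : ℕ) := by linarith
  exact_mod_cast h3

lemma tendsto_measure_not_hall [∀ n, IsProbabilityMeasure (ν n)] (hb : 1 ≤ b) (hε : 0 < ε) :
    Tendsto (fun N : ℕ => (Measure.pi fun n : Fin N => Measure.pi fun _ : Fin (b * N) => ν n).real
      {h | ¬ ∀ S : Finset (Fin N),
        b * S.card ≤ (S.biUnion fun n => topSet (numBest b ε (b * N)) (h n)).card})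
      atTop (𝓝 0) := by
  obtain ⟨δ, hδ1, hδ0, hδ⟩ : ∃ δ : ℝ, δ ≤ 1 ∧ 0 < δ ∧ (1 + ε) * (1 - δ) = 1 + ε / 2 := by
    -- This `δ` spends half of the margin `ε` in `M` on the loss `s ≥ (1 - δ) N`.
    refine ⟨ε / (2 * (1 + ε)), ?_, by positivity, by field_simp; ring⟩
    rw [div_le_one (by positivity)]
    linarith
  have hq : Tendsto (fun N : ℕ => Real.exp (1 + b) * (1 - δ) ^ (numBest b ε (b * N) - 1 - b))
      atTop (𝓝 0) := by
    rw [← mul_zero (Real.exp (1 + b))]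
    refine Tendsto.const_mul _ ((tendsto_pow_atTop_nhds_zero_of_lt_one (by linarith)
      (by linarith)).comp ?_)
    exact (tendsto_sub_atTop_nat b).comp
      ((tendsto_sub_atTop_nat 1).comp (tendsto_numBest_atTop hb hε))
  have hr : Tendsto (fun N : ℕ => Real.exp (-(ε / 2 * Real.log (b * N : ℕ)))) atTop (𝓝 0) :=
    Real.tendsto_exp_neg_atTop_nhds_zero.comp
      ((tendsto_log_mul_atTop hb).const_mul_atTop (by positivity))
  have hlim := (hq.const_mul 2).add (hr.const_mul 2)
  rw [mul_zero, add_zero] at hlim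
  refine squeeze_zero' (Eventually.of_forall fun _ => measureReal_nonneg) ?_ hlim
  filter_upwards [eventually_ge_atTop 1, eventually_two_mul_numBest_le hb hε,
    (tendsto_numBest_atTop hb hε).eventually_ge_atTop (1 + b),
    hq.eventually_le_const (show (0 : ℝ) < 1 / 2 by norm_num),
    hr.eventually_le_const (show (0 : ℝ) < 1 / 2 by norm_num)] with N h1 h2 h3 h4 h5
  exact measure_not_hall_le_geometric hb h1 hε hδ1 hδ (by omega) h3 (le_numBest _) h4 h5

/-- With `L = ln K` this is the bound `K * K ^ (B L + 1) * exp (-K ^ (1/3) / 2)`. -/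
lemma tendsto_exp_quadratic_sub_exp (B : ℝ) :
    Tendsto (fun L : ℝ => Real.exp (L + (B * L + 1) * L - Real.exp (L / 3) / 2)) atTop (𝓝 0) := by
  refine Real.tendsto_exp_atBot.comp (tendsto_atBot_mono' _ ?_ tendsto_neg_atTop_atBot)
  filter_upwards [eventually_const_mul_rpow_le_exp (2 * (3 + |B|)) 1 2
    (show (0 : ℝ) < 1 / 3 by norm_num) one_pos, eventually_ge_atTop 1] with L hL hL1
  rw [one_mul, Real.rpow_two, one_div_mul_eq_div] at hL
  nlinarith [mul_le_mul_of_nonneg_right (le_abs_self B) (sq_nonneg L)]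

/-- A tail of at least `K ^ (-2/3)` and `K - M ≥ K / 2` give a factor `exp (-K ^ (1/3) / 2)`, which
beats the `N * K ^ M` choices since `M = O(log K)`. -/
lemma tendsto_measure_exists_card_lt [∀ n, IsProbabilityMeasure (ν n)] (hb : 1 ≤ b) (hε : 0 < ε)
    {l : ℝ → ℕ → ℝ}
    (hl : ∀ᶠ L : ℝ in atTop, ∀ n, Real.exp (-(2 / 3 * L)) ≤ 1 - cdf (ν n) (l L n)) :
    Tendsto (fun N : ℕ => (Measure.pi fun n : Fin N => Measure.pi fun _ : Fin (b * N) => ν n).real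
      {h | ∃ n : Fin N, (Finset.univ.filter fun j => l (Real.log (b * N : ℕ)) n < h n j).card <
        numBest b ε (b * N)}) atTop (𝓝 0) := by
  have hlog := tendsto_log_mul_atTop hb
  refine squeeze_zero' (Eventually.of_forall fun _ => measureReal_nonneg) ?_
    ((tendsto_exp_quadratic_sub_exp (((b : ℝ) + 1) * (1 + ε))).comp hlog)
  filter_upwards [eventually_ge_atTop 1, eventually_two_mul_numBest_le hb hε,
    hlog.eventually hl, hlog.eventually_ge_atTop 0] with N hN hM hp hL0
  have hK : 1 ≤ b * N := Nat.mul_pos hb hN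
  have hNK : N ≤ b * N := Nat.le_mul_of_pos_left _ hb
  have hMB := numBest_le (b := b) hε hK
  refine (measure_exists_card_lt_le (show numBest b ε (b * N) ≤ b * N by omega) _).trans ?_
  rw [Function.comp_apply]
  generalize numBest b ε (b * N) = M at *
  generalize b * N = K at *
  have hKexp : (K : ℝ) = Real.exp (Real.log K) :=
    (Real.exp_log (by exact_mod_cast hK)).symm
  set L := Real.log K
  have hterm : ∀ n : ℕ, (K.choose M : ℝ) * (ν n).real (Set.Iic (l L n)) ^ (K - M) ≤
      Real.exp ((((b : ℝ) + 1) * (1 + ε) * L + 1) * L - Real.exp (L / 3) / 2) := by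
    intro n
    have h1 : (ν n).real (Set.Iic (l L n)) ≤ Real.exp (-Real.exp (-(2 / 3 * L))) := by
      rw [← cdf_eq_real]
      have := Real.one_sub_le_exp_neg (Real.exp (-(2 / 3 * L)))
      linarith [hp n]
    have h2 : Real.exp (L / 3) / 2 ≤ ((K - M : ℕ) : ℝ) * Real.exp (-(2 / 3 * L)) := by
      have h3 : (K : ℝ) / 2 ≤ ((K - M : ℕ) : ℝ) := by
        rw [Nat.cast_sub (by omega)]
        have : (2 * M : ℝ) ≤ K := by exact_mod_cast hM
        linarith
      calc Real.exp (L / 3) / 2 = (K : ℝ) / 2 * Real.exp (-(2 / 3 * L)) := by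
            rw [hKexp, div_mul_eq_mul_div, ← Real.exp_add]
            congr 2
            ring
        _ ≤ _ := by gcongr
    calc (K.choose M : ℝ) * (ν n).real (Set.Iic (l L n)) ^ (K - M)
        ≤ (K : ℝ) ^ M * Real.exp (-Real.exp (-(2 / 3 * L))) ^ (K - M) := by
          gcongr
          exact_mod_cast Nat.choose_le_pow K M
      _ = Real.exp (M * L - ((K - M : ℕ) : ℝ) * Real.exp (-(2 / 3 * L))) := by
          rw [hKexp, ← Real.exp_nat_mul, ← Real.exp_nat_mul, ← Real.exp_add]
          congr 1
          ring
      _ ≤ _ := by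
          gcongr
  refine (Finset.sum_le_card_nsmul _ _ _ fun (n : Fin N) _ => hterm n).trans ?_
  rw [Finset.card_univ, Fintype.card_fin, nsmul_eq_mul]
  calc (N : ℝ) * Real.exp ((((b : ℝ) + 1) * (1 + ε) * L + 1) * L - Real.exp (L / 3) / 2)
      ≤ Real.exp L *
        Real.exp ((((b : ℝ) + 1) * (1 + ε) * L + 1) * L - Real.exp (L / 3) / 2) := by
        rw [← hKexp]
        gcongr
    _ = _ := by
        rw [← Real.exp_add]
        congr 1
        ring

/-- There are at most `K ^ 2` gains, each beyond the threshold with probability at most `(1 + |C|) K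
^ (-3)`. Absolute values are needed because the rate depends on the squared gain. -/
lemma tendsto_measure_exists_lt_abs [∀ n, IsProbabilityMeasure (ν n)] (hb : 1 ≤ b)
    {u : ℝ → ℕ → ℝ} {C : ℝ}
    (hu : ∀ᶠ L : ℝ in atTop, ∀ n, 1 - cdf (ν n) (u L n) ≤ Real.exp (-(3 * L)))
    (hlow : ∀ᶠ L : ℝ in atTop, ∀ n,
      (ν n).real (Set.Iio (-u L n)) ≤ C * (ν n).real (Set.Ioi (u L n))) :
    Tendsto (fun N : ℕ => (Measure.pi fun n : Fin N => Measure.pi fun _ : Fin (b * N) => ν n).real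
      {h | ∃ (n : Fin N) (k : Fin (b * N)), u (Real.log (b * N : ℕ)) n < |h n k|})
      atTop (𝓝 0) := by
  have hlog := tendsto_log_mul_atTop hb
  have hlim : Tendsto (fun N : ℕ => (1 + |C|) * Real.exp (-Real.log (b * N : ℕ))) atTop (𝓝 0) := by
    rw [← mul_zero (1 + |C|)]
    exact (Real.tendsto_exp_neg_atTop_nhds_zero.comp hlog).const_mul _
  refine squeeze_zero' (Eventually.of_forall fun _ => measureReal_nonneg) ?_ hlim
  filter_upwards [eventually_ge_atTop 1, hlog.eventually hu, hlog.eventually hlow]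
    with N hN hu hlow
  have hK : 1 ≤ b * N := Nat.mul_pos hb hN
  have hNK : N ≤ b * N := Nat.le_mul_of_pos_left _ hb
  refine (measure_exists_lt_abs_le (K := b * N)
    fun n : Fin N => u (Real.log (b * N : ℕ)) n).trans ?_
  generalize b * N = K at *
  have hKexp : (K : ℝ) = Real.exp (Real.log K) :=
    (Real.exp_log (by exact_mod_cast hK)).symm
  set L := Real.log K
  have hterm : ∀ n : ℕ, (K : ℝ) * (ν n).real {x | u L n < |x|} ≤
      Real.exp L * ((1 + |C|) * Real.exp (-(3 * L))) := by
    intro n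
    rw [← hKexp]
    gcongr
    have hsub : {x | u L n < |x|} ⊆ Set.Ioi (u L n) ∪ Set.Iio (-u L n) := by
      intro x hx
      rcases lt_abs.1 (show u L n < |x| from hx) with h | h
      · exact Or.inl h
      · exact Or.inr (lt_neg_of_lt_neg h)
    have htail := hu n
    rw [← measureReal_Ioi_eq_one_sub_cdf] at htail
    calc (ν n).real {x | u L n < |x|}
        ≤ (ν n).real (Set.Ioi (u L n)) + (ν n).real (Set.Iio (-u L n)) :=
          (measureReal_mono hsub).trans (measureReal_union_le _ _)
      _ ≤ (ν n).real (Set.Ioi (u L n)) + |C| * (ν n).real (Set.Ioi (u L n)) := by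
          gcongr
          exact (hlow n).trans (by gcongr; exact le_abs_self C)
      _ = (1 + |C|) * (ν n).real (Set.Ioi (u L n)) := by ring
      _ ≤ _ := by gcongr
  refine (Finset.sum_le_card_nsmul _ _ _ fun (n : Fin N) _ => hterm n).trans ?_
  rw [Finset.card_univ, Fintype.card_fin, nsmul_eq_mul]
  calc (N : ℝ) * (Real.exp L * ((1 + |C|) * Real.exp (-(3 * L))))
      ≤ Real.exp L * (Real.exp L * ((1 + |C|) * Real.exp (-(3 * L)))) := by
        gcongr
        rw [← hKexp]
        exact_mod_cast hNK
    _ = (1 + |C|) * (Real.exp L * Real.exp L * Real.exp (-(3 * L))) := by ring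
    _ = _ := by
        rw [← Real.exp_add, ← Real.exp_add]
        congr 2
        ring

variable {Pmax N₀ η : ℝ}

lemma tendsto_measure_not_isTypical [∀ n, IsProbabilityMeasure (ν n)] (hb : 1 ≤ b) (hε : 0 < ε)
    (hPmax : 0 < Pmax) (hN₀ : 0 < N₀) (htail : UniformExpDominatedTail ν α β lam γ)
    (hlow : ∃ C : ℝ, ∀ᶠ x : ℝ in atTop, ∀ n,
      (ν n).real (Set.Iio (-x)) ≤ C * (ν n).real (Set.Ioi x)) (hη : 0 < η) :
    Tendsto (fun N : ℕ => (Measure.pi fun n : Fin N => Measure.pi fun _ : Fin (b * N) => ν n).real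
      {h | ¬ IsTypical b (numBest b ε (b * N)) Pmax N₀ η
        (fun n : Fin N => 2 / γ n * Real.logb 2 (Real.log (b * N : ℕ))) h}) atTop (𝓝 0) := by
  obtain ⟨c, C, hc, hbd⟩ := htail.bounds
  have hC : 0 < C := hc.trans_le ((hbd 0).1.1.trans (hbd 0).1.2)
  obtain ⟨C', hC'⟩ := hlow
  obtain ⟨X, hX⟩ := eventually_atTop.1 hC'
  have hlog := tendsto_log_mul_atTop hb
  have hb0 : (0 : ℝ) < b := by exact_mod_cast hb
  -- `lam n * a ≤ 1/2` with slack `1/6` gives tails at least `K ^ (-2/3)`; `lam n * A ≥ 4` with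
  -- slack 1 gives tails at most `K ^ (-3)`.
  set a : ℝ := 1 / (2 * C) with ha_def
  set A : ℝ := 4 / c with hA_def
  have ha : 0 < a := by positivity
  have hA : 0 < A := by positivity
  have hAL : Tendsto (fun L : ℝ => A * L) atTop atTop := tendsto_id.const_mul_atTop hA
  have hlo : ∀ᶠ L : ℝ in atTop, ∀ n,
      Real.exp (-(2 / 3 * L)) ≤ 1 - cdf (ν n) ((a * L) ^ (1 / γ n)) := by
    filter_upwards [htail.eventually_tail_mem_Icc ha (show (0 : ℝ) < 1 / 6 by norm_num),
      eventually_ge_atTop 0] with L hL hL0 n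
    refine le_trans (Real.exp_le_exp.2 (neg_le_neg ?_)) (hL n).1
    have : lam n * a ≤ 1 / 2 := by
      rw [ha_def, mul_one_div, div_le_iff₀ (by positivity)]
      linarith [(hbd n).2.2.1.2]
    exact mul_le_mul_of_nonneg_right (by linarith) hL0
  have hhi : ∀ᶠ L : ℝ in atTop, ∀ n,
      1 - cdf (ν n) ((A * L) ^ (1 / γ n)) ≤ Real.exp (-(3 * L)) := by
    filter_upwards [htail.eventually_tail_mem_Icc hA one_pos,
      eventually_ge_atTop 0] with L hL hL0 n
    refine (hL n).2.trans (Real.exp_le_exp.2 (neg_le_neg ?_))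
    have : 4 ≤ lam n * A := by
      rw [hA_def, mul_div_assoc', le_div_iff₀ hc]
      linarith [(hbd n).2.2.1.1]
    exact mul_le_mul_of_nonneg_right (by linarith) hL0
  have hlow : ∀ᶠ L : ℝ in atTop, ∀ n, (ν n).real (Set.Iio (-(A * L) ^ (1 / γ n))) ≤
      C' * (ν n).real (Set.Ioi ((A * L) ^ (1 / γ n))) := by
    filter_upwards [((tendsto_rpow_atTop (show 0 < 1 / C by positivity)).comp
      hAL).eventually_ge_atTop X, hAL.eventually_ge_atTop 1] with L h1 h2 n
    refine hX _ (h1.trans (Real.rpow_le_rpow_of_exponent_le h2 ?_)) n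
    exact one_div_le_one_div_of_le (hc.trans_le (hbd n).2.2.2.1) (hbd n).2.2.2.2
  have hlim := ((tendsto_measure_not_hall (ν := ν) hb hε).add
    (tendsto_measure_exists_card_lt (l := fun L n => (a * L) ^ (1 / γ n)) hb hε hlo)).add
    (tendsto_measure_exists_lt_abs (u := fun L n => (A * L) ^ (1 / γ n)) hb hhi hlow)
  rw [add_zero, add_zero] at hlim
  refine squeeze_zero' (Eventually.of_forall fun _ => measureReal_nonneg) ?_ hlim
  have hc₀ : 0 < Pmax / (b * N₀) := by positivity
  filter_upwards [hlog.eventually (eventually_logb_mem_Icc hc₀ ha hc hC hη),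
    hlog.eventually (eventually_logb_mem_Icc hc₀ hA hc hC hη),
    hlog.eventually_ge_atTop 0] with N h1 h2 hL0
  refine (measureReal_mono ?_).trans ((measureReal_union_le _ _).trans
    (add_le_add_left (measureReal_union_le _ _) _))
  intro h hh
  by_contra hnot
  simp only [Set.mem_union, Set.mem_ofPred_eq, not_or, not_not, not_exists, not_lt] at hnot
  obtain ⟨⟨hHall, hcard⟩, habs⟩ := hnot
  refine hh ⟨hHall, fun n k hk => ?_, fun n k => ?_⟩
  · refine (h1 (γ n) (hbd n).2.2.2).1.trans ?_
    have hlt := lt_of_mem_topSet (hcard n) hk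
    rw [mul_div_assoc, mul_comm (Pmax / _)]
    refine Real.logb_le_logb_of_le (by norm_num) (by positivity) ?_
    gcongr
  · refine le_trans ?_ (h2 (γ n) (hbd n).2.2.2).2
    have hle := habs n k
    rw [mul_div_assoc, mul_comm (Pmax / _)]
    refine Real.logb_le_logb_of_le (by norm_num) (by positivity) ?_
    gcongr 1 + ?_ * _
    exact sq_le_sq.2 (hle.trans (le_abs_self _))

end Asymptotics

end ChannelAllocation

/-! ### Convergence in probability of the two ratios -/

open ChannelAllocation in
theorem theorem2 {Ω : Type*} [MeasurableSpace Ω] (μ : Measure Ω) [IsProbabilityMeasure μ]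
    (b : ℕ) (hb : 1 ≤ b) (ε : ℝ) (hε : 0 < ε)
    (Pmax N₀ : ℝ) (hPmax : 0 < Pmax) (hN₀ : 0 < N₀)
    -- the law of the gains of user `n`, and the parameters of its tail
    (ν : ℕ → Measure ℝ) (α β lam γ : ℕ → ℝ)
    (htail : UniformExpDominatedTail ν α β lam γ)
    -- the lower tails are at most of the order of the upper tails (e.g. nonnegative gains)
    (hlow : ∃ C : ℝ, ∀ᶠ x : ℝ in atTop, ∀ n,
      (ν n).real (Set.Iio (-x)) ≤ C * (ν n).real (Set.Ioi x))
    -- the gains in the system with `N` users and `K = b * N` channels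
    (g : (N : ℕ) → Fin N → Fin (b * N) → Ω → ℝ)
    (hlaw : ∀ N n k, HasLaw (g N n k) (ν n) μ)
    (hindep : ∀ N, iIndepFun (fun p : Fin N × Fin (b * N) => g N p.1 p.2) μ) :
    TendstoInMeasure μ
      (fun N ω =>
        worstPMSumRate b (numBest b ε (b * N)) Pmax N₀ (fun n k => g N n k ω) /
          bestSumRate b Pmax N₀ (fun n k => g N n k ω))
      atTop (fun _ => 1) ∧
    ((∀ n m, γ n = γ m) →
      TendstoInMeasure μ
        (fun N ω =>
          worstPMMinRate b (numBest b ε (b * N)) Pmax N₀ (fun n k => g N n k ω) /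
            bestUserRate b Pmax N₀ (fun n k => g N n k ω))
        atTop (fun _ => 1)) := by
  -- User `n` already occurs in the system with `n + 1` users.
  have hprob : ∀ n, IsProbabilityMeasure (ν n) := fun n =>
    (hlaw (n + 1) ⟨n, n.lt_succ_self⟩ ⟨0, Nat.mul_pos hb n.succ_pos⟩).isProbabilityMeasure_iff.1
      inferInstance
  have hγ0 : ∀ n, 0 < γ n := fun n => (htail.tail n).gamma_pos
  have htyp : ∀ η : ℝ, 0 < η → Tendsto (fun N : ℕ => μ.real {ω | ¬ IsTypical b
      (numBest b ε (b * N)) Pmax N₀ η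
      (fun n : Fin N => 2 / γ n * Real.logb 2 (Real.log (b * N : ℕ)))
      (fun n k => g N n k ω)}) atTop (𝓝 0) := by
    intro η hη
    refine squeeze_zero (fun _ => measureReal_nonneg) (fun N => ?_)
      (tendsto_measure_not_isTypical hb hε hPmax hN₀ htail hlow hη)
    have hQ := hasLaw_gainMatrix (ν := fun n : Fin N => ν n) (hlaw N) (hindep N)
    rw [measureReal_def, measureReal_def]
    refine ENNReal.toReal_mono (measure_ne_top _ _) ?_
    rw [← hQ.map_eq]
    -- Valid for arbitrary sets, so `IsTypical` need not be a measurable event.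
    exact Measure.le_map_apply hQ.aemeasurable _
  have hpos : ∀ᶠ N : ℕ in atTop, 1 ≤ N ∧ ∀ n, 0 < 2 / γ n * Real.logb 2 (Real.log (b * N : ℕ)) := by
    filter_upwards [eventually_ge_atTop 1, (tendsto_log_mul_atTop hb).eventually_gt_atTop 1]
      with N h1 h2
    exact ⟨h1, fun n => mul_pos (div_pos two_pos (hγ0 n)) (Real.logb_pos (by norm_num) h2)⟩
  have key : ∀ X : ℕ → Ω → ℝ, (∀ η : ℝ, 0 < η → η < 1 → ∀ᶠ N : ℕ in atTop, ∀ ω, IsTypical b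
      (numBest b ε (b * N)) Pmax N₀ η
      (fun n : Fin N => 2 / γ n * Real.logb 2 (Real.log (b * N : ℕ)))
      (fun n k => g N n k ω) → |X N ω - 1| ≤ 2 * η) →
      TendstoInMeasure μ X atTop (fun _ => 1) := by
    intro X hX
    rw [tendstoInMeasure_iff_measureReal_norm]
    intro e he
    obtain ⟨η, hη, hη1, hηe⟩ : ∃ η : ℝ, 0 < η ∧ η < 1 ∧ 2 * η < e :=
      ⟨min (e / 4) (1 / 2), by positivity, by
        linarith [min_le_right (e / 4) (1 / 2 : ℝ)], by linarith [min_le_left (e / 4) (1 / 2 : ℝ)]⟩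
    refine squeeze_zero' (Eventually.of_forall fun _ => measureReal_nonneg) ?_ (htyp η hη)
    filter_upwards [hX η hη hη1] with N hN
    refine measureReal_mono fun ω hω hω' => ?_
    have h1 := hN ω hω'
    have h2 : e ≤ |X N ω - 1| := hω
    linarith
  refine ⟨key _ fun η hη hη1 => ?_, fun hγ => key _ fun η hη hη1 => ?_⟩
  · filter_upwards [hpos] with N hN ω ht
    exact ht.abs_sumRate_ratio_sub_one_le hb hN.1 hη hη1 fun n => hN.2 n
  · filter_upwards [hpos] with N hN ω ht
    exact ht.abs_userRate_ratio_sub_one_le hb hN.1 hη hη1 (hN.2 0) fun n => by rw [hγ n 0]
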